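/- Let $(\Delta,\mathcal F,\mathbb P)$ be a probability space, $F:\mathbb R^n\to\mathbb R^n$ a map, and $\{\mathcal X_\delta\}_{\delta\in\Delta}$ a family of set-valued maps, $\mathcal X_\delta(x)\subseteq\mathbb R^n$ for $x\in\mathbb R^n$. For a tuple $(\delta_1,\dots,\delta_m)\in\Delta^m$ and $I\subseteq\{1,\dots,m\}$, consider the quasi variational inequality $\mathrm{QVI}(I)$: find $x$ with $x\in\mathcal X_I(x):=\bigcap_{i\in I}\mathcal X_{\delta_i}(x)$ and $F(x)^\top(y-x)\ge 0$ for all $y\in\mathcal X_I(x)$. Assume that for every $m\ge 1$ and every tuple $(\delta_1,\dots,\delta_m)\in\Delta^m$ the problem $\mathrm{QVI}(\{1,\dots,m\})$ has exactly one solution, that this solution is a measurable function of the tuple, and that the set $\{(x,\delta): x\in\mathcal X_\delta(x)\}$ is measurable. Fix $N\ge 1$ and let $\delta_1,\dots,\delta_N$ be independent samples from $\mathbb P$. Let $x^\star$ be the unique solution of $\mathrm{QVI}(\{1,\dots,N\})$. The $i$-th constraint is of support if its removal modifies the solution, that is, if the solution set of $\mathrm{QVI}(\{1,\dots,N\}\setminus\{i\})$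 is not $\{x^\star\}$; let $S^\star$ be the set of indices of the support constraints and $s^\star=|S^\star|$. Assume non-degeneracy: $\mathbb P^N$-almost surely, the solution set of $\mathrm{QVI}(S^\star)$ is $\{x^\star\}$. Let $V(x)=\mathbb P\{\delta\in\Delta: x\notin\mathcal X_\delta(x)\}$ be the risk of $x$. Let $\beta\in(0,1)$. For $k\in\{0,\dots,N-1\}$ let $t(k)$ be the unique solution in $(0,1)$ of $$\frac{\beta}{N+1}\sum_{l=k}^{N}\binom{l}{k}t^{l-k}-\binom{N}{k}t^{N-k}=0,$$ and let $t(k)=0$ for $k\ge N$. Then $$\mathbb P^N\left[V(x^\star)\le 1-t(s^\star)\right]\ge 1-\beta .$$ Moreover, $s^\star\le n$ for every tuple $(\delta_1,\dots,\delta_N)$ for which the sets $\mathcal X_{\delta_1}(x^\star),\dots,\mathcal X_{\delta_N}(x^\star)$ are convex; and if these sets are convex $\mathbb P^N$-almost surely, then $$\mathbb P^N\left[V(x^\star)\le 1-t(n)\right]\ge 1-\beta .$$ -/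

import Mathlib

open MeasureTheory

noncomputable section

namespace ScenarioQVI

/-- The polynomial in the unknown `t` whose root in `(0,1)` defines `t(k)`. -/
def scenarioPoly (β : ℝ) (N k : ℕ) (t : ℝ) : ℝ :=
  β / (N + 1) * ∑ l ∈ Finset.Icc k N, (l.choose k : ℝ) * t ^ (l - k)
    - (N.choose k : ℝ) * t ^ (N - k)

theorem existsUnique_scenarioPoly_root {β : ℝ} (hβ : β ∈ Set.Ioo (0 : ℝ) 1) {N k : ℕ}
    (hk : k < N) : ∃! t : ℝ, t ∈ Set.Ioo (0 : ℝ) 1 ∧ scenarioPoly β N k t = 0 := by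
  obtain ⟨hβ0, hβ1⟩ := hβ
  have hN : (0 : ℝ) < N + 1 := by positivity
  have hc : (0 : ℝ) < β / (N + 1) := by positivity
  have hcont : Continuous (scenarioPoly β N k) := by
    unfold scenarioPoly; fun_prop
  have h0 : 0 < scenarioPoly β N k 0 := by
    unfold scenarioPoly
    have h1 : ∑ l ∈ Finset.Icc k N, (l.choose k : ℝ) * (0 : ℝ) ^ (l - k) = 1 := by
      rw [Finset.sum_eq_single k]
      · simp
      · intro l hl hlk
        have : l - k ≠ 0 := by
          have := (Finset.mem_Icc.1 hl).1
          omega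
        simp [this]
      · intro h; exact absurd (Finset.mem_Icc.2 ⟨le_refl k, hk.le⟩) h
    have h2 : N - k ≠ 0 := by omega
    rw [h1]; simp [h2]; positivity
  have h1 : scenarioPoly β N k 1 < 0 := by
    unfold scenarioPoly
    have hs : ∑ l ∈ Finset.Icc k N, (l.choose k : ℝ) = ((N + 1).choose (k + 1) : ℝ) := by
      exact_mod_cast Nat.sum_Icc_choose N k
    have hm : ((N : ℝ) + 1) * (N.choose k : ℝ) = ((N + 1).choose (k + 1) : ℝ) * (k + 1) := by
      exact_mod_cast Nat.add_one_mul_choose_eq N k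
    have hp : (0 : ℝ) < (N.choose k : ℝ) := by exact_mod_cast Nat.choose_pos hk.le
    have hp' : (0 : ℝ) ≤ ((N + 1).choose (k + 1) : ℝ) := by positivity
    have hle : ((N + 1).choose (k + 1) : ℝ) ≤ ((N : ℝ) + 1) * (N.choose k : ℝ) := by
      rw [hm]
      have : (0 : ℝ) ≤ k := by positivity
      nlinarith
    simp only [one_pow, mul_one, hs]
    have : β / (N + 1) * ((N + 1).choose (k + 1) : ℝ) ≤ β * (N.choose k : ℝ) := by
      calc β / (N + 1) * ((N + 1).choose (k + 1) : ℝ)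
          ≤ β / (N + 1) * (((N : ℝ) + 1) * (N.choose k : ℝ)) := by gcongr
        _ = β * (N.choose k : ℝ) := by field_simp
    nlinarith
  obtain ⟨t, ht, hroot⟩ : ∃ t ∈ Set.Ioo (0 : ℝ) 1, scenarioPoly β N k t = 0 := by
    have := intermediate_value_Ioo' (zero_le_one' ℝ) hcont.continuousOn
    obtain ⟨t, ht, h⟩ := this ⟨h1, h0⟩
    exact ⟨t, ht, h⟩
  have key : ∀ s t : ℝ, 0 < s → s < t → scenarioPoly β N k s = 0 →
      scenarioPoly β N k t = 0 → False := by
    intro s t hs hst hs0 ht0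
    have ht : 0 < t := hs.trans hst
    unfold scenarioPoly at hs0 ht0
    have hlt : ∑ l ∈ Finset.Icc k N, (l.choose k : ℝ) * t ^ (l - k) * s ^ (N - k)
        < ∑ l ∈ Finset.Icc k N, (l.choose k : ℝ) * s ^ (l - k) * t ^ (N - k) := by
      have hsplit : ∀ l ∈ Finset.Icc k N, ∀ a : ℝ,
          a ^ (N - k) = a ^ (l - k) * a ^ (N - l) := by
        intro l hl a
        have := Finset.mem_Icc.1 hl
        rw [← pow_add]; congr 1; omega
      apply Finset.sum_lt_sum
      · intro l hl
        rw [hsplit l hl s, hsplit l hl t]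
        have h3 : s ^ (N - l) ≤ t ^ (N - l) := pow_le_pow_left₀ hs.le hst.le _
        have h4 : (0 : ℝ) ≤ (l.choose k : ℝ) * t ^ (l - k) * s ^ (l - k) := by positivity
        nlinarith [mul_le_mul_of_nonneg_left h3 h4]
      · refine ⟨k, Finset.mem_Icc.2 ⟨le_refl k, hk.le⟩, ?_⟩
        have : s ^ (N - k) < t ^ (N - k) := pow_lt_pow_left₀ hst hs.le (by omega)
        simpa using this
    rw [← Finset.sum_mul, ← Finset.sum_mul] at hlt
    have := mul_lt_mul_of_pos_left hlt hc
    have e1 : β / (N + 1) * ((∑ l ∈ Finset.Icc k N, (l.choose k : ℝ) * t ^ (l - k))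
        * s ^ (N - k)) = (N.choose k : ℝ) * t ^ (N - k) * s ^ (N - k) := by
      rw [← mul_assoc, sub_eq_zero.1 ht0]
    have e2 : β / (N + 1) * ((∑ l ∈ Finset.Icc k N, (l.choose k : ℝ) * s ^ (l - k))
        * t ^ (N - k)) = (N.choose k : ℝ) * s ^ (N - k) * t ^ (N - k) := by
      rw [← mul_assoc, sub_eq_zero.1 hs0]
    rw [e1, e2] at this
    nlinarith
  refine ⟨t, ⟨ht, hroot⟩, ?_⟩
  rintro s ⟨hs, hs0⟩
  rcases lt_trichotomy s t with h | h | h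
  · exact (key s t hs.1 h hs0 hroot).elim
  · exact h
  · exact (key t s ht.1 h hroot hs0).elim

/-- The map `t : ℕ → ℝ`: for `k < N` the unique root of `scenarioPoly β N k` in `(0,1)`,
and `0` for `k ≥ N`. -/
def scenarioT (β : ℝ) (hβ : β ∈ Set.Ioo (0 : ℝ) 1) (N k : ℕ) : ℝ :=
  if hk : k < N then (existsUnique_scenarioPoly_root hβ hk).choose else 0

variable {Δ : Type*} {n : ℕ}

/-- The solution set of the quasi variational inequality in which only the constraints `X (ω i)`
with `i ∈ I` are imposed: the points `x` with `x ∈ 𝒳(x) := ⋂ i ∈ I, X (ω i) x` and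
`F(x)ᵀ (y - x) ≥ 0` for all `y ∈ 𝒳(x)`. -/
def solutionSet (F : EuclideanSpace ℝ (Fin n) → EuclideanSpace ℝ (Fin n))
    (X : Δ → EuclideanSpace ℝ (Fin n) → Set (EuclideanSpace ℝ (Fin n)))
    {m : ℕ} (ω : Fin m → Δ) (I : Set (Fin m)) : Set (EuclideanSpace ℝ (Fin n)) :=
  {x | (x ∈ ⋂ i ∈ I, X (ω i) x) ∧ ∀ y ∈ (⋂ i ∈ I, X (ω i) x), 0 ≤ inner ℝ (F x) (y - x)}

open Classical in
/-- The set of support constraints: those whose removal modifies the solution. (The solution set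
is compared rather than a solution, so that the problem that is left after the removal of the only
constraint need not be uniquely solvable.) -/
def supportSet (F : EuclideanSpace ℝ (Fin n) → EuclideanSpace ℝ (Fin n))
    (X : Δ → EuclideanSpace ℝ (Fin n) → Set (EuclideanSpace ℝ (Fin n)))
    {m : ℕ} (ω : Fin m → Δ) : Finset (Fin m) :=
  Finset.univ.filter fun i => solutionSet F X ω {i}ᶜ ≠ solutionSet F X ω Set.univ

/-- Non-degeneracy: almost surely, eliminating all the constraints that are not of support does
not change the solution. -/
def NonDegenerate [MeasurableSpace Δ] (μ : Measure Δ)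
    (F : EuclideanSpace ℝ (Fin n) → EuclideanSpace ℝ (Fin n))
    (X : Δ → EuclideanSpace ℝ (Fin n) → Set (EuclideanSpace ℝ (Fin n))) (N : ℕ) : Prop :=
  ∀ᵐ ω ∂(Measure.pi fun _ : Fin N => μ),
    solutionSet F X ω (supportSet F X ω : Set (Fin N)) = solutionSet F X ω Set.univ

/-- The risk of `x`. -/
def risk [MeasurableSpace Δ] (μ : Measure Δ)
    (X : Δ → EuclideanSpace ℝ (Fin n) → Set (EuclideanSpace ℝ (Fin n)))
    (x : EuclideanSpace ℝ (Fin n)) : ℝ :=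
  μ.real {δ | x ∉ X δ x}

end ScenarioQVI

end

namespace ScenarioQVI

/-! ### The function `t` -/

section Root

variable {β : ℝ} (hβ : β ∈ Set.Ioo (0 : ℝ) 1) {N k : ℕ}

/-! Let `v` be the probability that a point is feasible for a new sample, i.e. one minus its risk.
Call `I` essential if its subproblem has a unique solution `x_I` and no index can be dropped without
changing the solution set. By non-degeneracy the support set is almost surely the only essential set
whose solution satisfies all `N` constraints (`eq_supportSet`). Hence the bad event is covered, up
to a null set, by the events that `I` is essential, `0 < v(x_I) < t(|I|)` and `x_I` is feasible for
the samples outside `I`. With `k = |I|`, independence gives each of them the probability `∫ v^(N-k)`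
over the part that depends on `I` only.

Their sum is bounded by a duality argument. For a set `T` of `m` indices, the analogous events for
`I ⊆ T` are almost disjoint (`aedisjoint_essentialEvent_inter`), although non-degeneracy is assumed
for `N` samples only: an overlap of positive probability would survive, since `v > 0`, when the
other `N - m` samples are required to be feasible too. Averaging over `T` gives `∑_I C(m,k)/C(N,k) ∫
v^(m-k) ≤ 1` for `m = 0, …, N`. Weighted by `β/(N+1)`, these inequalities add up to the bound `β`,
and the polynomial defining `t(k)` says that the weighted sum dominates the wanted one for `v <
t(k)` (`choose_mul_integral_essentialEvent_le`).

In the convex case Helly's theorem bounds the number of support constraints (`card_supportSet_le`),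
and `t` is antitone (`antitone_scenarioT`). -/

theorem scenarioT_mem_Ioo (hk : k < N) : scenarioT β hβ N k ∈ Set.Ioo (0 : ℝ) 1 := by
  rw [scenarioT, dif_pos hk]
  exact (existsUnique_scenarioPoly_root hβ hk).choose_spec.1.1

theorem scenarioPoly_scenarioT (hk : k < N) : scenarioPoly β N k (scenarioT β hβ N k) = 0 := by
  rw [scenarioT, dif_pos hk]
  exact (existsUnique_scenarioPoly_root hβ hk).choose_spec.1.2

theorem scenarioT_of_le (hk : N ≤ k) : scenarioT β hβ N k = 0 := by
  rw [scenarioT, dif_neg (not_lt.2 hk)]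

theorem scenarioT_nonneg (N k : ℕ) : 0 ≤ scenarioT β hβ N k := by
  rcases lt_or_ge k N with hk | hk
  · exact (scenarioT_mem_Ioo hβ hk).1.le
  · exact (scenarioT_of_le hβ hk).ge

theorem eq_scenarioT (hk : k < N) {t : ℝ} (ht : t ∈ Set.Ioo (0 : ℝ) 1)
    (h : scenarioPoly β N k t = 0) : t = scenarioT β hβ N k :=
  (existsUnique_scenarioPoly_root hβ hk).unique ⟨ht, h⟩
    ⟨scenarioT_mem_Ioo hβ hk, scenarioPoly_scenarioT hβ hk⟩

theorem continuous_scenarioPoly (β : ℝ) (N k : ℕ) : Continuous (scenarioPoly β N k) := by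
  unfold scenarioPoly; fun_prop

theorem scenarioPoly_zero_pos (hβ0 : 0 < β) (hk : k < N) : 0 < scenarioPoly β N k 0 := by
  have h1 : ∑ l ∈ Finset.Icc k N, (l.choose k : ℝ) * (0 : ℝ) ^ (l - k) = 1 := by
    rw [Finset.sum_eq_single k]
    · simp
    · intro l hl hlk
      have : l - k ≠ 0 := by
        have := (Finset.mem_Icc.1 hl).1
        omega
      simp [this]
    · intro h; exact absurd (Finset.mem_Icc.2 ⟨le_refl k, hk.le⟩) h
  have h2 : N - k ≠ 0 := by omega
  rw [scenarioPoly, h1]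
  simp only [zero_pow h2]
  have : 0 < β / ((N : ℝ) + 1) := by positivity
  linarith

/-- The polynomial is positive at `0`, so a negative value at `t` would force a root in `(0,1)`
smaller than the unique one. -/
theorem scenarioPoly_nonneg (hk : k < N) {t : ℝ} (ht0 : 0 ≤ t) (ht : t ≤ scenarioT β hβ N k) :
    0 ≤ scenarioPoly β N k t := by
  by_contra! hneg
  obtain ⟨s, hs, hs0⟩ := intermediate_value_Ioo' ht0
    (continuous_scenarioPoly β N k).continuousOn ⟨hneg, scenarioPoly_zero_pos hβ.1 hk⟩
  have h1 := (scenarioT_mem_Ioo hβ hk).2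
  have := eq_scenarioT hβ hk ⟨hs.1, hs.2.trans_le (ht.trans h1.le)⟩ hs0
  linarith [hs.2]

/-! ### Monotonicity of `t` -/

/-- The ratio `C(l,k+1)/C(l,k) = (l-k)/(k+1)` increases with `l`. -/
theorem choose_succ_mul_choose_le {l N : ℕ} (h : l ≤ N) (k : ℕ) :
    l.choose (k + 1) * N.choose k ≤ l.choose k * N.choose (k + 1) := by
  refine Nat.le_of_mul_le_mul_right ?_ (Nat.succ_pos k)
  calc l.choose (k + 1) * N.choose k * (k + 1)
      = (l.choose (k + 1) * (k + 1)) * N.choose k := by ring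
    _ = l.choose k * N.choose k * (l - k) := by rw [Nat.choose_succ_right_eq]; ring
    _ ≤ l.choose k * N.choose k * (N - k) := by gcongr
    _ = l.choose k * (N.choose (k + 1) * (k + 1)) := by rw [Nat.choose_succ_right_eq]; ring
    _ = l.choose k * N.choose (k + 1) * (k + 1) := by ring

/-- The scaling makes the subtracted monomials agree; the sums are then compared term by term, with
the term `l = k` dropped. -/
theorem choose_mul_scenarioPoly_succ_le (hβ0 : 0 ≤ β) (hk : k < N) {t : ℝ} (ht : 0 ≤ t) :
    (N.choose k : ℝ) * (t * scenarioPoly β N (k + 1) t)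
      ≤ (N.choose (k + 1) : ℝ) * scenarioPoly β N k t := by
  have hc : 0 ≤ β / ((N : ℝ) + 1) := by positivity
  have hlast : t * t ^ (N - (k + 1)) = t ^ (N - k) := by
    rw [← pow_succ']; congr 1; omega
  have hsum : (N.choose k : ℝ) *
      (t * ∑ l ∈ Finset.Icc (k + 1) N, (l.choose (k + 1) : ℝ) * t ^ (l - (k + 1)))
      ≤ (N.choose (k + 1) : ℝ) * ∑ l ∈ Finset.Icc k N, (l.choose k : ℝ) * t ^ (l - k) := by
    rw [Finset.mul_sum, Finset.mul_sum, Finset.mul_sum]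
    refine (Finset.sum_le_sum fun l hl => ?_).trans
      (Finset.sum_le_sum_of_subset_of_nonneg (Finset.Icc_subset_Icc_left k.le_succ)
        fun l _ _ => by positivity)
    have hl' := Finset.mem_Icc.1 hl
    have e : t * t ^ (l - (k + 1)) = t ^ (l - k) := by
      rw [← pow_succ']; congr 1; omega
    have h : ((l.choose (k + 1) * N.choose k : ℕ) : ℝ) ≤ (l.choose k * N.choose (k + 1) : ℕ) :=
      Nat.cast_le.2 (choose_succ_mul_choose_le hl'.2 k)
    push_cast at h
    calc (N.choose k : ℝ) * (t * ((l.choose (k + 1) : ℝ) * t ^ (l - (k + 1))))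
        = ((l.choose (k + 1) : ℝ) * N.choose k) * (t * t ^ (l - (k + 1))) := by ring
      _ ≤ ((l.choose k : ℝ) * N.choose (k + 1)) * (t * t ^ (l - (k + 1))) := by gcongr
      _ = _ := by rw [e]; ring
  have := mul_le_mul_of_nonneg_left hsum hc
  unfold scenarioPoly
  calc _ = β / ((N : ℝ) + 1) * ((N.choose k : ℝ) *
      (t * ∑ l ∈ Finset.Icc (k + 1) N, (l.choose (k + 1) : ℝ) * t ^ (l - (k + 1))))
      - (N.choose k : ℝ) * (N.choose (k + 1) : ℝ) * (t * t ^ (N - (k + 1))) := by ring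
    _ ≤ _ := by rw [hlast]; linarith

theorem antitone_scenarioT (N : ℕ) : Antitone (scenarioT β hβ N) := by
  refine antitone_nat_of_succ_le fun k => ?_
  rcases lt_or_ge (k + 1) N with hk | hk
  · have hk' : k < N := by omega
    have ht := scenarioT_mem_Ioo hβ hk'
    by_contra! hlt
    -- If `t(k) < t(k+1)`, the polynomial for `k+1` is nonnegative at `t(k)` by position and
    -- nonpositive by the comparison, so `t(k)` would be its root.
    have hnn := scenarioPoly_nonneg hβ hk ht.1.le hlt.le
    have hle := choose_mul_scenarioPoly_succ_le (k := k) hβ.1.le hk' ht.1.le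
    rw [scenarioPoly_scenarioT hβ hk', mul_zero, ← mul_assoc] at hle
    have hpos : 0 < (N.choose k : ℝ) * scenarioT β hβ N k :=
      mul_pos (by exact_mod_cast Nat.choose_pos hk'.le) ht.1
    have h0 : scenarioPoly β N (k + 1) (scenarioT β hβ N k) = 0 :=
      le_antisymm (nonpos_of_mul_nonpos_right hle hpos) hnn
    exact hlt.ne (eq_scenarioT hβ hk ht h0)
  · rw [scenarioT_of_le hβ hk]
    exact scenarioT_nonneg hβ N k

end Root

/-! ### Solutions of the subproblems -/

section Subproblem

variable {Δ : Type*} {n N : ℕ} {F : EuclideanSpace ℝ (Fin n) → EuclideanSpace ℝ (Fin n)}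
  {X : Δ → EuclideanSpace ℝ (Fin n) → Set (EuclideanSpace ℝ (Fin n))}
  {xs : ∀ m : ℕ, (Fin m → Δ) → EuclideanSpace ℝ (Fin n)}

theorem mem_solutionSet {m : ℕ} {ω : Fin m → Δ} {I : Set (Fin m)} {x : EuclideanSpace ℝ (Fin n)} :
    x ∈ solutionSet F X ω I ↔ (∀ i ∈ I, x ∈ X (ω i) x) ∧
      ∀ y, (∀ i ∈ I, y ∈ X (ω i) x) → 0 ≤ inner ℝ (F x) (y - x) := by
  simp [solutionSet]

theorem mem_solutionSet_of_subset {m : ℕ} {ω : Fin m → Δ} {I J : Set (Fin m)}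
    {x : EuclideanSpace ℝ (Fin n)} (hx : x ∈ solutionSet F X ω I) (hIJ : I ⊆ J)
    (hJ : ∀ j ∈ J, x ∈ X (ω j) x) : x ∈ solutionSet F X ω J :=
  mem_solutionSet.2 ⟨hJ, fun y hy => (mem_solutionSet.1 hx).2 y fun i hi => hy i (hIJ hi)⟩

theorem solutionSet_congr {ω ω' : Fin N → Δ} {I : Set (Fin N)} (h : ∀ i ∈ I, ω i = ω' i) :
    solutionSet F X ω I = solutionSet F X ω' I := by
  ext x
  rw [mem_solutionSet, mem_solutionSet]
  simp +contextual [h]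

/-- The solutions of the problem without constraints. -/
def freeSolutions (F : EuclideanSpace ℝ (Fin n) → EuclideanSpace ℝ (Fin n)) :
    Set (EuclideanSpace ℝ (Fin n)) :=
  {x | ∀ y, 0 ≤ inner ℝ (F x) (y - x)}

theorem solutionSet_empty (ω : Fin N → Δ) : solutionSet F X ω ∅ = freeSolutions F := by
  ext x; simp [mem_solutionSet, freeSolutions]

open Classical in
/-- The solution of the problem with the constraints in `I`, for empty `I` whenever it is unique. -/
noncomputable def subSolution (F : EuclideanSpace ℝ (Fin n) → EuclideanSpace ℝ (Fin n))
    (xs : ∀ m : ℕ, (Fin m → Δ) → EuclideanSpace ℝ (Fin n)) (I : Finset (Fin N))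
    (ω : Fin N → Δ) : EuclideanSpace ℝ (Fin n) :=
  if I.Nonempty then xs I.card fun j => ω (I.orderEmbOfFin rfl j)
  else Classical.epsilon fun x => freeSolutions F = {x}

/-- The problem with the constraints in `I` has exactly one solution. -/
def UniquelySolvable (F : EuclideanSpace ℝ (Fin n) → EuclideanSpace ℝ (Fin n))
    (I : Finset (Fin N)) : Prop :=
  I.Nonempty ∨ ∃ x, freeSolutions F = {x}

theorem solutionSet_orderEmbOfFin (ω : Fin N → Δ) (I : Finset (Fin N)) :
    solutionSet F X (fun j => ω (I.orderEmbOfFin rfl j)) Set.univ = solutionSet F X ω I := by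
  have key : ∀ P : Fin N → Prop,
      (∀ j ∈ (Set.univ : Set (Fin I.card)), P (I.orderEmbOfFin rfl j)) ↔
        ∀ i ∈ (I : Set (Fin N)), P i := by
    intro P
    rw [← Finset.range_orderEmbOfFin I rfl, Set.forall_mem_range]
    simp only [Set.mem_univ, true_imp_iff]
  ext x
  rw [mem_solutionSet, mem_solutionSet, key fun i => x ∈ X (ω i) x]
  exact and_congr_right fun _ => forall_congr' fun y => by rw [key fun i => y ∈ X (ω i) x]

/-- This splits an equation between sets into a condition independent of `ω` and an equation between
measurable functions, which makes the later events measurable. -/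
theorem solutionSet_eq_singleton_iff
    (hxs : ∀ m : ℕ, 1 ≤ m → ∀ ω : Fin m → Δ, solutionSet F X ω Set.univ = {xs m ω})
    (ω : Fin N → Δ) (I : Finset (Fin N)) (y : EuclideanSpace ℝ (Fin n)) :
    solutionSet F X ω I = {y} ↔ UniquelySolvable F I ∧ subSolution F xs I ω = y := by
  by_cases hI : I.Nonempty
  · rw [← solutionSet_orderEmbOfFin, hxs _ hI.card_pos, Set.singleton_eq_singleton_iff,
      subSolution, if_pos hI]
    simp [UniquelySolvable, hI]
  · rw [subSolution, if_neg hI]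
    rw [Finset.not_nonempty_iff_eq_empty] at hI
    subst hI
    rw [Finset.coe_empty, solutionSet_empty]
    simp only [UniquelySolvable, Finset.not_nonempty_empty, false_or]
    constructor
    · intro h
      refine ⟨⟨y, h⟩, ?_⟩
      have := Classical.epsilon_spec (p := fun x => freeSolutions F = {x}) ⟨y, h⟩
      exact Set.singleton_injective (this.symm.trans h)
    · rintro ⟨h, rfl⟩
      exact Classical.epsilon_spec h

/-- More constraints leave fewer competitors `y`, so a feasible solution remains one. Uniqueness is
inherited: either `J` is nonempty, or the unconstrained problem is already uniquely solvable. -/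
theorem solutionSet_eq_singleton_of_subset
    (hxs : ∀ m : ℕ, 1 ≤ m → ∀ ω : Fin m → Δ, solutionSet F X ω Set.univ = {xs m ω})
    {ω : Fin N → Δ} {I J : Finset (Fin N)} {x : EuclideanSpace ℝ (Fin n)}
    (hI : solutionSet F X ω I = {x}) (hIJ : I ⊆ J) (hJ : ∀ j ∈ J, x ∈ X (ω j) x) :
    solutionSet F X ω J = {x} := by
  have hU : UniquelySolvable F J := by
    rcases ((solutionSet_eq_singleton_iff hxs ω I x).1 hI).1 with h | h
    · exact Or.inl (h.mono hIJ)
    · exact Or.inr h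
  have hJ' := (solutionSet_eq_singleton_iff hxs ω J _).2 ⟨hU, rfl⟩
  have hx : x ∈ solutionSet F X ω J :=
    mem_solutionSet_of_subset (hI ▸ Set.mem_singleton x) (Finset.coe_subset.2 hIJ) hJ
  rw [hJ'] at hx ⊢
  rw [Set.mem_singleton_iff.1 hx]

theorem mem_of_solutionSet_eq {ω : Fin N → Δ} {I : Set (Fin N)} {x : EuclideanSpace ℝ (Fin n)}
    (h : solutionSet F X ω I = {x}) {i : Fin N} (hi : i ∈ I) : x ∈ X (ω i) x :=
  (mem_solutionSet.1 (h ▸ Set.mem_singleton x : x ∈ solutionSet F X ω I)).1 i hi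

/-! ### Support constraints and irreducible subfamilies -/

theorem mem_supportSet {ω : Fin N → Δ} {i : Fin N} :
    i ∈ supportSet F X ω ↔
      solutionSet F X ω (({i}ᶜ : Finset (Fin N)) : Set (Fin N)) ≠
        solutionSet F X ω ((Finset.univ : Finset (Fin N)) : Set (Fin N)) := by
  simp [supportSet]

theorem solutionSet_erase_supportSet_ne
    (hxs : ∀ m : ℕ, 1 ≤ m → ∀ ω : Fin m → Δ, solutionSet F X ω Set.univ = {xs m ω})
    {ω : Fin N → Δ} {x : EuclideanSpace ℝ (Fin n)}
    (hx : solutionSet F X ω (Finset.univ : Finset (Fin N)) = {x})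
    {i : Fin N} (hi : i ∈ supportSet F X ω) :
    solutionSet F X ω ((supportSet F X ω).erase i) ≠ {x} := by
  intro h
  refine mem_supportSet.1 hi ?_
  rw [hx]
  exact solutionSet_eq_singleton_of_subset hxs h
    (fun j hj => by simpa using (Finset.mem_erase.1 hj).1) fun j _ => mem_of_solutionSet_eq hx (by simp)

/-- A support index outside `I` is impossible, because its removal leaves a family that still
contains `I`. Conversely, for `i ∈ I` outside the support set, `I.erase i` contains the support set,
which determines `x` by non-degeneracy; this contradicts the irreducibility of `I`. -/
theorem eq_supportSet
    (hxs : ∀ m : ℕ, 1 ≤ m → ∀ ω : Fin m → Δ, solutionSet F X ω Set.univ = {xs m ω})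
    {ω : Fin N → Δ}
    (hnd : solutionSet F X ω (supportSet F X ω) = solutionSet F X ω Set.univ)
    {I : Finset (Fin N)} {x : EuclideanSpace ℝ (Fin n)} (hI : solutionSet F X ω I = {x})
    (hmin : ∀ i ∈ I, solutionSet F X ω (I.erase i) ≠ {x}) (hx : ∀ j, x ∈ X (ω j) x) :
    I = supportSet F X ω := by
  have huniv := solutionSet_eq_singleton_of_subset hxs hI (Finset.subset_univ I) fun j _ => hx j
  rw [← Finset.coe_univ, huniv] at hnd
  have hsub : supportSet F X ω ⊆ I := by
    intro i hi
    by_contra hiI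
    refine mem_supportSet.1 hi ?_
    rw [huniv]
    exact solutionSet_eq_singleton_of_subset hxs hI
      (fun j hj => by simpa using ne_of_mem_of_not_mem hj hiI) fun j _ => hx j
  refine (hsub.antisymm fun i hi => ?_).symm
  by_contra hiS
  exact hmin i hi (solutionSet_eq_singleton_of_subset hxs hnd
    (fun j hj => Finset.mem_erase.2 ⟨ne_of_mem_of_not_mem hj hiS, hsub hj⟩) fun j _ => hx j)

theorem subSolution_congr {ω ω' : Fin N → Δ} {I : Finset (Fin N)} (h : ∀ i ∈ I, ω i = ω' i) :
    subSolution F xs I ω = subSolution F xs I ω' := by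
  unfold subSolution
  congr 2
  funext j
  exact h _ (I.orderEmbOfFin_mem rfl j)

theorem measurable_subSolution [MeasurableSpace Δ] (hxs_meas : ∀ m : ℕ, 1 ≤ m → Measurable (xs m))
    (I : Finset (Fin N)) : Measurable (subSolution F xs I) := by
  unfold subSolution
  by_cases hI : I.Nonempty
  · simp only [if_pos hI]
    exact (hxs_meas _ hI.card_pos).comp (measurable_pi_lambda _ fun j => measurable_pi_apply _)
  · simp only [if_neg hI]
    exact measurable_const

/-! ### The number of support constraints -/

/-- Freezing the constraint sets at `x`, each support index `i` yields a point `y i` that violates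
at most constraint `i` and lies in the open half-space `F(x)ᵀ(z - x) < 0`. With more than `n` such
indices, Helly's theorem produces a point of the half-space satisfying all constraints, against the
variational inequality at `x`. -/
theorem card_supportSet_le
    (hxs : ∀ m : ℕ, 1 ≤ m → ∀ ω : Fin m → Δ, solutionSet F X ω Set.univ = {xs m ω})
    (hN : 1 ≤ N) (ω : Fin N → Δ) (hconv : ∀ i, Convex ℝ (X (ω i) (xs N ω))) :
    (supportSet F X ω).card ≤ n := by
  set x := xs N ω with hx
  have hsol : solutionSet F X ω (Finset.univ : Finset (Fin N)) = {x} := by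
    rw [Finset.coe_univ, hxs N hN ω]
  have hmem : ∀ j, x ∈ X (ω j) x := fun j => mem_of_solutionSet_eq hsol (by simp)
  have hpos := (mem_solutionSet.1 (hsol ▸ Set.mem_singleton x :
    x ∈ solutionSet F X ω (Finset.univ : Finset (Fin N)))).2
  rcases Nat.eq_zero_or_pos n with rfl | hn
  · rw [Nat.le_zero, Finset.card_eq_zero, Finset.eq_empty_iff_forall_notMem]
    intro i hi
    refine mem_supportSet.1 hi ?_
    rw [hsol]
    ext y
    rw [Subsingleton.elim y x, mem_solutionSet]
    refine ⟨fun _ => rfl, fun _ => ⟨fun j _ => hmem j, fun y _ => ?_⟩⟩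
    rw [Subsingleton.elim y x, sub_self, inner_zero_right]
  -- For `N = 1` the removal leaves the unconstrained problem, whose solvability is not assumed; the
  -- bound is then trivial as `n ≥ 1`.
  rcases hN.eq_or_lt with rfl | hN2
  · exact (Finset.card_le_univ _).trans (by rwa [Fintype.card_fin])
  have hy : ∀ i ∈ supportSet F X ω, ∃ y, (∀ j, j ≠ i → y ∈ X (ω j) x) ∧
      inner ℝ (F x) (y - x) < 0 := by
    intro i hi
    by_contra! hcon
    refine mem_supportSet.1 hi ?_
    have hne : UniquelySolvable F ({i}ᶜ : Finset (Fin N)) := Or.inl <| by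
      rw [← Finset.card_pos, Finset.card_compl, Finset.card_singleton, Fintype.card_fin]
      omega
    have hs := (solutionSet_eq_singleton_iff (X := X) hxs ω _ _).2 ⟨hne, rfl⟩
    have hxmem : x ∈ solutionSet F X ω ({i}ᶜ : Finset (Fin N)) :=
      mem_solutionSet.2 ⟨fun j _ => hmem j, fun y hy => hcon y fun j hj => hy j (by simpa using hj)⟩
    rw [hs] at hxmem ⊢
    rw [hsol, ← Set.mem_singleton_iff.1 hxmem]
  choose! y hyX hyF using hy
  by_contra! hcard
  have hHconv : Convex ℝ {z : EuclideanSpace ℝ (Fin n) | inner ℝ (F x) (z - x) < 0} := by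
    have : {z : EuclideanSpace ℝ (Fin n) | inner ℝ (F x) (z - x) < 0}
        = {z | (innerSL ℝ (F x)) z < inner ℝ (F x) x} := by
      ext z; simp [inner_sub_right]
    rw [this]
    exact convex_halfSpace_lt (innerSL ℝ (F x)).isLinear _
  have hCconv : Convex ℝ {z | ∀ j, j ∉ supportSet F X ω → z ∈ X (ω j) x} := by
    have : {z | ∀ j, j ∉ supportSet F X ω → z ∈ X (ω j) x}
        = ⋂ j, ⋂ (_ : j ∉ supportSet F X ω), X (ω j) x := by
      ext z; simp
    rw [this]
    exact convex_iInter₂ fun j _ => hconv j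
  -- The Helly family: the half-space (`none`) and the support constraints, each cut with all the
  -- other constraints. A subfamily of at most `n + 1` sets omits a member: `x` is a common point if
  -- that is the half-space, `y i` if it is constraint `i`.
  let D : Option (Fin N) → Set (EuclideanSpace ℝ (Fin n)) := fun o =>
    (o.elim {z | inner ℝ (F x) (z - x) < 0} fun i => X (ω i) x) ∩
      {z | ∀ j, j ∉ supportSet F X ω → z ∈ X (ω j) x}
  have hhelly : (⋂ o ∈ (supportSet F X ω).insertNone, D o).Nonempty := by
    refine Convex.helly_theorem (𝕜 := ℝ) ?_ ?_ ?_
    · rw [finrank_euclideanSpace_fin, Finset.card_insertNone]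
      omega
    · rintro (_ | i) -
      · exact hHconv.inter hCconv
      · exact (hconv i).inter hCconv
    · intro J hJ hJcard
      rw [finrank_euclideanSpace_fin] at hJcard
      obtain ⟨o, ho, hoJ⟩ : ∃ o ∈ (supportSet F X ω).insertNone, o ∉ J := by
        by_contra! hall
        have := Finset.card_le_card (show (supportSet F X ω).insertNone ⊆ J from hall)
        rw [Finset.card_insertNone] at this
        omega
      rcases o with _ | i
      · refine ⟨x, Set.mem_iInter₂.2 fun o' ho' => ?_⟩
        rcases o' with _ | j
        · exact absurd ho' hoJ
        · exact ⟨hmem j, fun j _ => hmem j⟩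
      · have hi : i ∈ supportSet F X ω := by simpa using ho
        refine ⟨y i, Set.mem_iInter₂.2 fun o' ho' => ?_⟩
        have hrest : ∀ j, j ∉ supportSet F X ω → y i ∈ X (ω j) x :=
          fun j hj => hyX i hi j (ne_of_mem_of_not_mem hi hj).symm
        rcases o' with _ | j
        · exact ⟨hyF i hi, hrest⟩
        · exact ⟨hyX i hi j (by rintro rfl; exact hoJ ho'), hrest⟩
  obtain ⟨z, hz⟩ := hhelly
  rw [Set.mem_iInter₂] at hz
  have hz0 := hz none (by simp)
  refine absurd (hpos z fun j _ => ?_) (not_le.2 hz0.1)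
  by_cases hj : j ∈ supportSet F X ω
  · exact (hz (some j) (by simpa using hj)).1
  · exact hz0.2 j hj

end Subproblem

end ScenarioQVI

namespace ScenarioQVI

/-! ### Independence of the coordinates of a product measure -/

section Independence

variable {ι Δ E : Type*} [Fintype ι] [DecidableEq ι] [MeasurableSpace Δ] [MeasurableSpace E]
  (μ : Measure Δ) [IsProbabilityMeasure μ]

/-- Resampling the coordinates outside `T` does not change the law; Fubini then amounts to
conditioning on the coordinates in `T`. -/
theorem measurePreserving_piecewise (T : Finset ι) :
    MeasurePreserving (fun p : (ι → Δ) × (ι → Δ) => T.piecewise p.1 p.2)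
      ((Measure.pi fun _ => μ).prod (Measure.pi fun _ => μ)) (Measure.pi fun _ => μ) := by
  have hmeas : Measurable (fun p : (ι → Δ) × (ι → Δ) => T.piecewise p.1 p.2) := by
    refine measurable_pi_lambda _ fun i => ?_
    by_cases hi : i ∈ T
    · simp only [Finset.piecewise, hi, if_true]
      exact (measurable_pi_apply i).comp measurable_fst
    · simp only [Finset.piecewise, hi, if_false]
      exact (measurable_pi_apply i).comp measurable_snd
  refine ⟨hmeas, (Measure.pi_eq fun s hs => ?_).symm⟩
  rw [Measure.map_apply hmeas (MeasurableSet.univ_pi hs)]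
  have hpre : (fun p : (ι → Δ) × (ι → Δ) => T.piecewise p.1 p.2) ⁻¹' Set.pi Set.univ s
      = Set.pi Set.univ (fun i => if i ∈ T then s i else Set.univ) ×ˢ
        Set.pi Set.univ (fun i => if i ∈ T then Set.univ else s i) := by
    ext p
    simp only [Set.mem_preimage, Set.mem_pi, Set.mem_univ, true_imp_iff, Set.mem_prod,
      ← forall_and]
    refine forall_congr' fun i => ?_
    by_cases hi : i ∈ T <;> simp [Finset.piecewise, hi]
  rw [hpre, Measure.prod_prod, Measure.pi_pi, Measure.pi_pi, ← Finset.prod_mul_distrib]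
  refine Finset.prod_congr rfl fun i _ => ?_
  by_cases hi : i ∈ T <;> simp [hi]

/-- Given the coordinates in `T`, both `G` and `f` are fixed, and the samples in `K` fall
independently into the same section of `B`. -/
theorem measure_inter_forall_mem {T K : Finset ι} (hTK : Disjoint T K) {G : Set (ι → Δ)}
    (hG : MeasurableSet G) (hGT : ∀ ω ω' : ι → Δ, (∀ i ∈ T, ω i = ω' i) → (ω ∈ G ↔ ω' ∈ G))
    {f : (ι → Δ) → E} (hf : Measurable f)
    (hfT : ∀ ω ω' : ι → Δ, (∀ i ∈ T, ω i = ω' i) → f ω = f ω')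
    {B : Set (E × Δ)} (hB : MeasurableSet B) :
    (Measure.pi fun _ => μ) (G ∩ {ω | ∀ j ∈ K, (f ω, ω j) ∈ B})
      = ∫⁻ ω in G, (μ (Prod.mk (f ω) ⁻¹' B)) ^ K.card ∂(Measure.pi fun _ => μ) := by
  have hA : MeasurableSet (G ∩ {ω | ∀ j ∈ K, (f ω, ω j) ∈ B}) := by
    refine hG.inter ?_
    have : {ω : ι → Δ | ∀ j ∈ K, (f ω, ω j) ∈ B} = ⋂ j ∈ K, (fun ω => (f ω, ω j)) ⁻¹' B := by
      ext ω; simp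
    rw [this]
    exact Finset.measurableSet_biInter _ fun j _ => (hf.prodMk (measurable_pi_apply j)) hB
  have hmp := measurePreserving_piecewise μ T
  rw [← hmp.measure_preimage hA.nullMeasurableSet, Measure.prod_apply (hmp.measurable hA),
    ← lintegral_indicator hG]
  refine lintegral_congr fun ω => ?_
  have hpw : ∀ ω' : ι → Δ, ∀ i ∈ T, T.piecewise ω ω' i = ω i := fun ω' i hi =>
    Finset.piecewise_eq_of_mem _ _ _ hi
  by_cases hω : ω ∈ G
  · rw [Set.indicator_of_mem hω]
    have : Prod.mk ω ⁻¹' ((fun p : (ι → Δ) × (ι → Δ) => T.piecewise p.1 p.2) ⁻¹'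
        (G ∩ {ω | ∀ j ∈ K, (f ω, ω j) ∈ B}))
        = Set.pi Set.univ fun i => if i ∈ K then Prod.mk (f ω) ⁻¹' B else Set.univ := by
      ext ω'
      simp only [Set.mem_preimage, Set.mem_inter_iff, Set.mem_ofPred_eq, Set.mem_pi, Set.mem_univ,
        true_imp_iff, hGT _ _ (hpw ω'), hω, true_and, hfT _ _ (hpw ω')]
      refine forall_congr' fun i => ?_
      by_cases hi : i ∈ K
      · have hiT : i ∉ T := fun h => Finset.disjoint_left.1 hTK h hi
        simp [hi, hiT]
      · simp [hi]
    rw [this, Measure.pi_pi]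
    have hprod : ∀ i, μ (if i ∈ K then Prod.mk (f ω) ⁻¹' B else Set.univ)
        = if i ∈ K then μ (Prod.mk (f ω) ⁻¹' B) else 1 := by
      intro i; split_ifs <;> simp
    simp only [hprod, Finset.prod_ite_mem, Finset.univ_inter, Finset.prod_const]
  · rw [Set.indicator_of_notMem hω]
    convert measure_empty (μ := Measure.pi fun _ : ι => μ)
    ext ω'
    simp [hGT _ _ (hpw ω'), hω]

theorem measurable_measureReal_section {B : Set (E × Δ)} (hB : MeasurableSet B) :
    Measurable fun x => μ.real (Prod.mk x ⁻¹' B) :=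
  (measurable_measure_prodMk_left hB).ennreal_toReal

theorem integrable_measureReal_section_pow {Ω : Type*} [MeasurableSpace Ω] {ν : Measure Ω}
    [IsFiniteMeasure ν] {f : Ω → E} (hf : Measurable f) {B : Set (E × Δ)} (hB : MeasurableSet B)
    (k : ℕ) : Integrable (fun ω => μ.real (Prod.mk (f ω) ⁻¹' B) ^ k) ν := by
  refine Integrable.of_bound
    (((measurable_measureReal_section μ hB).comp hf).pow_const k).aestronglyMeasurable 1
    (Filter.Eventually.of_forall fun ω => ?_)
  rw [Real.norm_of_nonneg (by positivity)]
  exact pow_le_one₀ measureReal_nonneg measureReal_le_one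

theorem measureReal_inter_forall_mem {T K : Finset ι} (hTK : Disjoint T K) {G : Set (ι → Δ)}
    (hG : MeasurableSet G) (hGT : ∀ ω ω' : ι → Δ, (∀ i ∈ T, ω i = ω' i) → (ω ∈ G ↔ ω' ∈ G))
    {f : (ι → Δ) → E} (hf : Measurable f)
    (hfT : ∀ ω ω' : ι → Δ, (∀ i ∈ T, ω i = ω' i) → f ω = f ω')
    {B : Set (E × Δ)} (hB : MeasurableSet B) :
    (Measure.pi fun _ => μ).real (G ∩ {ω | ∀ j ∈ K, (f ω, ω j) ∈ B})
      = ∫ ω in G, μ.real (Prod.mk (f ω) ⁻¹' B) ^ K.card ∂(Measure.pi fun _ => μ) := by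
  rw [measureReal_def, measure_inter_forall_mem μ hTK hG hGT hf hfT hB,
    integral_eq_lintegral_of_nonneg_ae (Filter.Eventually.of_forall fun ω => by positivity)
      (integrable_measureReal_section_pow μ hf hB _).aestronglyMeasurable]
  congr 1
  refine lintegral_congr fun ω => ?_
  rw [ENNReal.ofReal_pow measureReal_nonneg, ofReal_measureReal]

end Independence

/-! ### Double counting -/

/-- Each `I` with at most `m` elements lies in as many `m`-sets as there are ways to choose the
remaining `m - |I|` elements from its complement. -/
theorem sum_powersetCard_sum_powerset {ι : Type*} [Fintype ι] [DecidableEq ι] (m : ℕ)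
    (g : Finset ι → ℝ) :
    ∑ T ∈ Finset.powersetCard m (Finset.univ : Finset ι), ∑ I ∈ T.powerset, g I
      = ∑ I ∈ (Finset.univ : Finset (Finset ι)).filter (fun I => I.card ≤ m),
        ((Fintype.card ι - I.card).choose (m - I.card) : ℝ) * g I := by
  rw [Finset.sum_comm' (t' := (Finset.univ : Finset (Finset ι)).filter fun I => I.card ≤ m)
    (s' := fun I => (Finset.powersetCard m Finset.univ).filter fun T => I ⊆ T)]
  · refine Finset.sum_congr rfl fun I hI => ?_
    have hIm : I.card ≤ m := (Finset.mem_filter.1 hI).2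
    rw [Finset.sum_const, nsmul_eq_mul]
    congr 2
    rw [← Finset.card_compl, ← Finset.card_powersetCard]
    refine Finset.card_nbij' (fun T => T \ I) (fun K => I ∪ K) ?_ ?_ ?_ ?_
    · intro T hT
      simp only [Finset.coe_filter, Finset.mem_powersetCard, Finset.subset_univ, true_and,
        Set.mem_ofPred_eq] at hT
      simp only [Finset.mem_coe, Finset.mem_powersetCard]
      refine ⟨fun i hi => by simpa using (Finset.mem_sdiff.1 hi).2, ?_⟩
      rw [Finset.card_sdiff_of_subset hT.2, hT.1]
    · intro K hK
      simp only [Finset.mem_coe, Finset.mem_powersetCard] at hK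
      simp only [Finset.coe_filter, Finset.mem_powersetCard, Finset.subset_univ, true_and,
        Set.mem_ofPred_eq, Finset.subset_union_left, and_true]
      have hd : Disjoint I K :=
        Finset.disjoint_left.2 fun i hi hiK => Finset.mem_compl.1 (hK.1 hiK) hi
      rw [Finset.card_union_of_disjoint hd, hK.2]
      omega
    · intro T hT
      simp only [Finset.coe_filter, Set.mem_ofPred_eq] at hT
      exact Finset.union_sdiff_of_subset hT.2
    · intro K hK
      simp only [Finset.mem_coe, Finset.mem_powersetCard] at hK
      have hd : Disjoint I K :=
        Finset.disjoint_left.2 fun i hi hiK => Finset.mem_compl.1 (hK.1 hiK) hi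
      exact Finset.union_sdiff_cancel_left hd
  · intro T I
    simp only [Finset.mem_powersetCard, Finset.subset_univ, true_and, Finset.mem_powerset,
      Finset.mem_filter, Finset.mem_univ]
    constructor
    · rintro ⟨rfl, h⟩
      exact ⟨⟨rfl, h⟩, Finset.card_le_card h⟩
    · rintro ⟨h, -⟩
      exact h

end ScenarioQVI

namespace ScenarioQVI

/-! ### Essential sets of constraints -/

section Feasible

variable {Δ : Type*} {n N : ℕ}
  (F : EuclideanSpace ℝ (Fin n) → EuclideanSpace ℝ (Fin n))
  (X : Δ → EuclideanSpace ℝ (Fin n) → Set (EuclideanSpace ℝ (Fin n)))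
  (xs : ∀ m : ℕ, (Fin m → Δ) → EuclideanSpace ℝ (Fin n))

/-- The event that the solution for `I` is feasible for the samples with index in `K`. -/
def feasEvent (I K : Finset (Fin N)) : Set (Fin N → Δ) :=
  {ω | ∀ j ∈ K, (subSolution F xs I ω, ω j) ∈
    {p : EuclideanSpace ℝ (Fin n) × Δ | p.1 ∈ X p.2 p.1}}

variable {F X xs} in
theorem feasEvent_congr {I K T : Finset (Fin N)} (hI : I ⊆ T) (hK : K ⊆ T) {ω ω' : Fin N → Δ}
    (h : ∀ i ∈ T, ω i = ω' i) : ω ∈ feasEvent F X xs I K ↔ ω' ∈ feasEvent F X xs I K := by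
  simp only [feasEvent, Set.mem_ofPred_eq, subSolution_congr fun i hi => h i (hI hi)]
  exact forall₂_congr fun j hj => by rw [h j (hK hj)]

end Feasible

section Essential

variable {Δ : Type*} [MeasurableSpace Δ] (μ : Measure Δ) {n N : ℕ}
  (F : EuclideanSpace ℝ (Fin n) → EuclideanSpace ℝ (Fin n))
  (X : Δ → EuclideanSpace ℝ (Fin n) → Set (EuclideanSpace ℝ (Fin n)))
  (xs : ∀ m : ℕ, (Fin m → Δ) → EuclideanSpace ℝ (Fin n))

/-- The probability that `x` is feasible for a new sample. -/
noncomputable def feasProb (x : EuclideanSpace ℝ (Fin n)) : ℝ :=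
  μ.real {δ | x ∈ X δ x}

/-- The event that the problem with the constraints in `I` is uniquely solvable, that no
constraint in `I` can be removed from it, and that its solution is feasible for a new sample with
a probability in `(0, r)`. -/
def essentialEvent (r : ℝ) (I : Finset (Fin N)) : Set (Fin N → Δ) :=
  {ω | solutionSet F X ω I = {subSolution F xs I ω} ∧
    (∀ i ∈ I, solutionSet F X ω (I.erase i) ≠ {subSolution F xs I ω}) ∧
    feasProb μ X (subSolution F xs I ω) ∈ Set.Ioo 0 r}

variable {μ F X xs}

/-! ### Locality and measurability of the essential events -/

theorem essentialEvent_congr {r : ℝ} {I : Finset (Fin N)} {ω ω' : Fin N → Δ}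
    (h : ∀ i ∈ I, ω i = ω' i) :
    ω ∈ essentialEvent μ F X xs r I ↔ ω' ∈ essentialEvent μ F X xs r I := by
  have h2 : ∀ i, solutionSet F X ω (I.erase i) = solutionSet F X ω' (I.erase i) := fun i =>
    solutionSet_congr fun j hj => h j (Finset.mem_of_mem_erase (Finset.mem_coe.1 hj))
  simp only [essentialEvent, Set.mem_ofPred_eq, h2, subSolution_congr h,
    solutionSet_congr (F := F) (X := X) (I := (I : Set (Fin N))) h]

theorem measurable_feasProb [IsProbabilityMeasure μ]
    (hX_meas : MeasurableSet {p : EuclideanSpace ℝ (Fin n) × Δ | p.1 ∈ X p.2 p.1}) :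
    Measurable (feasProb μ X) :=
  measurable_measureReal_section μ hX_meas

theorem risk_eq [IsProbabilityMeasure μ]
    (hX_meas : MeasurableSet {p : EuclideanSpace ℝ (Fin n) × Δ | p.1 ∈ X p.2 p.1})
    (x : EuclideanSpace ℝ (Fin n)) : risk μ X x = 1 - feasProb μ X x := by
  have hm : MeasurableSet {δ | x ∈ X δ x} := measurable_prodMk_left hX_meas
  exact probReal_compl_eq_one_sub hm

theorem measurableSet_essentialEvent [IsProbabilityMeasure μ]
    (hxs : ∀ m : ℕ, 1 ≤ m → ∀ ω : Fin m → Δ, solutionSet F X ω Set.univ = {xs m ω})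
    (hxs_meas : ∀ m : ℕ, 1 ≤ m → Measurable (xs m))
    (hX_meas : MeasurableSet {p : EuclideanSpace ℝ (Fin n) × Δ | p.1 ∈ X p.2 p.1})
    (r : ℝ) (I : Finset (Fin N)) : MeasurableSet (essentialEvent μ F X xs r I) := by
  have hsol : ∀ J : Finset (Fin N),
      MeasurableSet {ω | solutionSet F X ω J = {subSolution F xs I ω}} := by
    intro J
    simp only [solutionSet_eq_singleton_iff hxs]
    exact (MeasurableSet.const _).inter (measurableSet_eq_fun
      (measurable_subSolution hxs_meas J) (measurable_subSolution hxs_meas I))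
  have herase : MeasurableSet
      {ω | ∀ i ∈ I, solutionSet F X ω (I.erase i) ≠ {subSolution F xs I ω}} := by
    have : {ω | ∀ i ∈ I, solutionSet F X ω (I.erase i) ≠ {subSolution F xs I ω}}
        = ⋂ i ∈ I, {ω | solutionSet F X ω (I.erase i) = {subSolution F xs I ω}}ᶜ := by
      ext ω; simp
    rw [this]
    exact Finset.measurableSet_biInter _ fun i _ => (hsol _).compl
  exact (hsol I).inter (herase.inter
    (((measurable_feasProb hX_meas).comp (measurable_subSolution hxs_meas I)) measurableSet_Ioo))

theorem measurableSet_feasEvent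
    (hxs_meas : ∀ m : ℕ, 1 ≤ m → Measurable (xs m))
    (hX_meas : MeasurableSet {p : EuclideanSpace ℝ (Fin n) × Δ | p.1 ∈ X p.2 p.1})
    (I K : Finset (Fin N)) : MeasurableSet (feasEvent F X xs I K) := by
  have : feasEvent F X xs I K = ⋂ j ∈ K, (fun ω : Fin N → Δ => (subSolution F xs I ω, ω j)) ⁻¹'
      {p : EuclideanSpace ℝ (Fin n) × Δ | p.1 ∈ X p.2 p.1} := by
    ext ω; simp [feasEvent]
  rw [this]
  exact Finset.measurableSet_biInter _ fun j _ =>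
    ((measurable_subSolution hxs_meas I).prodMk (measurable_pi_apply j)) hX_meas

theorem measureReal_essentialEvent_inter [IsProbabilityMeasure μ]
    (hxs : ∀ m : ℕ, 1 ≤ m → ∀ ω : Fin m → Δ, solutionSet F X ω Set.univ = {xs m ω})
    (hxs_meas : ∀ m : ℕ, 1 ≤ m → Measurable (xs m))
    (hX_meas : MeasurableSet {p : EuclideanSpace ℝ (Fin n) × Δ | p.1 ∈ X p.2 p.1})
    (r : ℝ) (I T : Finset (Fin N)) :
    (Measure.pi fun _ : Fin N => μ).real
        (essentialEvent μ F X xs r I ∩ feasEvent F X xs I (T \ I))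
      = ∫ ω in essentialEvent μ F X xs r I, feasProb μ X (subSolution F xs I ω) ^ (T \ I).card
        ∂(Measure.pi fun _ : Fin N => μ) :=
  measureReal_inter_forall_mem μ Finset.disjoint_sdiff
    (measurableSet_essentialEvent hxs hxs_meas hX_meas r I) (fun _ _ h => essentialEvent_congr h)
    (measurable_subSolution hxs_meas I) (fun _ _ h => subSolution_congr h) hX_meas

/-- By non-degeneracy for `N` samples, at most one subset of `T` is essential and solves the
problem for `T`. -/
theorem aedisjoint_essentialEvent_inter [IsProbabilityMeasure μ]
    (hxs : ∀ m : ℕ, 1 ≤ m → ∀ ω : Fin m → Δ, solutionSet F X ω Set.univ = {xs m ω})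
    (hxs_meas : ∀ m : ℕ, 1 ≤ m → Measurable (xs m))
    (hX_meas : MeasurableSet {p : EuclideanSpace ℝ (Fin n) × Δ | p.1 ∈ X p.2 p.1})
    (hnd : NonDegenerate μ F X N) (r : Finset (Fin N) → ℝ) {I J T : Finset (Fin N)}
    (hI : I ⊆ T) (hJ : J ⊆ T) (hIJ : I ≠ J) :
    AEDisjoint (Measure.pi fun _ : Fin N => μ)
      (essentialEvent μ F X xs (r I) I ∩ feasEvent F X xs I (T \ I))
      (essentialEvent μ F X xs (r J) J ∩ feasEvent F X xs J (T \ J)) := by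
  set G := (essentialEvent μ F X xs (r I) I ∩ feasEvent F X xs I (T \ I)) ∩
    (essentialEvent μ F X xs (r J) J ∩ feasEvent F X xs J (T \ J)) with hGdef
  have hE : ∀ I : Finset (Fin N),
      MeasurableSet (essentialEvent μ F X xs (r I) I ∩ feasEvent F X xs I (T \ I)) := fun I =>
    (measurableSet_essentialEvent hxs hxs_meas hX_meas _ I).inter
      (measurableSet_feasEvent hxs_meas hX_meas _ _)
  have hG : MeasurableSet G := (hE I).inter (hE J)
  have hGT : ∀ ω ω' : Fin N → Δ, (∀ i ∈ T, ω i = ω' i) → (ω ∈ G ↔ ω' ∈ G) := by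
    intro ω ω' h
    simp only [hGdef, Set.mem_inter_iff, essentialEvent_congr fun i hi => h i (hI hi),
      essentialEvent_congr fun i hi => h i (hJ hi), feasEvent_congr hI Finset.sdiff_subset h,
      feasEvent_congr hJ Finset.sdiff_subset h]
  have hfeas : ∀ {I : Finset (Fin N)} {ω : Fin N → Δ},
      ω ∈ essentialEvent μ F X xs (r I) I ∩ feasEvent F X xs I (T \ I) →
      ∀ j ∈ T, subSolution F xs I ω ∈ X (ω j) (subSolution F xs I ω) := by
    intro I ω hω j hj
    by_cases hjI : j ∈ I
    · exact mem_of_solutionSet_eq hω.1.1 hjI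
    · exact hω.2 j (Finset.mem_sdiff.2 ⟨hj, hjI⟩)
  -- If the samples outside `T` are feasible as well, `I` and `J` both equal the support set, unless
  -- non-degeneracy fails at `ω`.
  have hzero : (Measure.pi fun _ : Fin N => μ) (G ∩ feasEvent F X xs I Tᶜ) = 0 := by
    refine measure_mono_null ?_ (ae_iff.1 hnd)
    rintro ω ⟨⟨hωI, hωJ⟩, hωT⟩ hndω
    have hxI := solutionSet_eq_singleton_of_subset hxs hωI.1.1 hI (hfeas hωI)
    have hxJ := solutionSet_eq_singleton_of_subset hxs hωJ.1.1 hJ (hfeas hωJ)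
    have hx : subSolution F xs J ω = subSolution F xs I ω :=
      Set.singleton_injective (hxJ.symm.trans hxI)
    have hall : ∀ j, subSolution F xs I ω ∈ X (ω j) (subSolution F xs I ω) := by
      intro j
      by_cases hj : j ∈ T
      · exact hfeas hωI j hj
      · exact hωT j (Finset.mem_compl.2 hj)
    have h1 := eq_supportSet hxs hndω hωI.1.1 hωI.1.2.1 hall
    have h2 := eq_supportSet hxs hndω hωJ.1.1 hωJ.1.2.1 (hx.symm ▸ hall)
    exact hIJ (h1.trans h2.symm)
  -- The same probability is the integral over `G` of a power of `v`. As `v > 0` on `G`, its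
  -- vanishing forces `G` to be null.
  have hint := measure_inter_forall_mem μ (disjoint_compl_right : Disjoint T Tᶜ) hG hGT
    (measurable_subSolution (F := F) hxs_meas I)
    (fun _ _ h => subSolution_congr fun i hi => h i (hI hi)) hX_meas
  have hmeas : Measurable fun ω => μ (Prod.mk (subSolution F xs I ω) ⁻¹'
      {p : EuclideanSpace ℝ (Fin n) × Δ | p.1 ∈ X p.2 p.1}) ^ Tᶜ.card :=
    ((measurable_measure_prodMk_left hX_meas).comp
      (measurable_subSolution hxs_meas I)).pow_const _
  have h0 := hint.symm.trans hzero
  rw [lintegral_eq_zero_iff hmeas, Filter.EventuallyEq, ae_restrict_iff' hG] at h0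
  refine measure_mono_null (fun ω hω => ?_) (ae_iff.1 h0)
  intro hcon
  have hz := eq_zero_of_pow_eq_zero (hcon hω)
  have hpos : 0 < feasProb μ X (subSolution F xs I ω) := hω.1.1.2.2.1
  refine hpos.ne' ?_
  rw [feasProb, measureReal_def]
  exact (ENNReal.toReal_eq_zero_iff _).2 (Or.inl hz)

theorem sum_integral_essentialEvent_le [IsProbabilityMeasure μ]
    (hxs : ∀ m : ℕ, 1 ≤ m → ∀ ω : Fin m → Δ, solutionSet F X ω Set.univ = {xs m ω})
    (hxs_meas : ∀ m : ℕ, 1 ≤ m → Measurable (xs m))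
    (hX_meas : MeasurableSet {p : EuclideanSpace ℝ (Fin n) × Δ | p.1 ∈ X p.2 p.1})
    (hnd : NonDegenerate μ F X N) (r : Finset (Fin N) → ℝ) (T : Finset (Fin N)) :
    ∑ I ∈ T.powerset, ∫ ω in essentialEvent μ F X xs (r I) I,
      feasProb μ X (subSolution F xs I ω) ^ (T.card - I.card)
        ∂(Measure.pi fun _ : Fin N => μ) ≤ 1 := by
  have h : ∀ I ∈ T.powerset, ∫ ω in essentialEvent μ F X xs (r I) I,
      feasProb μ X (subSolution F xs I ω) ^ (T.card - I.card) ∂(Measure.pi fun _ : Fin N => μ)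
      = (Measure.pi fun _ : Fin N => μ).real
        (essentialEvent μ F X xs (r I) I ∩ feasEvent F X xs I (T \ I)) := by
    intro I hI
    rw [measureReal_essentialEvent_inter hxs hxs_meas hX_meas,
      Finset.card_sdiff_of_subset (Finset.mem_powerset.1 hI)]
  rw [Finset.sum_congr rfl h, ← measureReal_biUnion_finset₀]
  · exact measureReal_le_one
  · intro I hI J hJ hIJ
    exact aedisjoint_essentialEvent_inter hxs hxs_meas hX_meas hnd r
      (Finset.mem_powerset.1 hI) (Finset.mem_powerset.1 hJ) hIJ
  · exact fun I _ => ((measurableSet_essentialEvent hxs hxs_meas hX_meas _ I).inter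
      (measurableSet_feasEvent hxs_meas hX_meas _ _)).nullMeasurableSet

/-- The average over the sets `T` with `m` elements of `sum_integral_essentialEvent_le`. -/
theorem sum_choose_div_choose_mul_integral_le [IsProbabilityMeasure μ]
    (hxs : ∀ m : ℕ, 1 ≤ m → ∀ ω : Fin m → Δ, solutionSet F X ω Set.univ = {xs m ω})
    (hxs_meas : ∀ m : ℕ, 1 ≤ m → Measurable (xs m))
    (hX_meas : MeasurableSet {p : EuclideanSpace ℝ (Fin n) × Δ | p.1 ∈ X p.2 p.1})
    (hnd : NonDegenerate μ F X N) (r : Finset (Fin N) → ℝ) {m : ℕ} (hm : m ≤ N) :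
    ∑ I ∈ (Finset.univ : Finset (Finset (Fin N))).filter (fun I => I.card ≤ m),
      (m.choose I.card : ℝ) / (N.choose I.card : ℝ) *
        ∫ ω in essentialEvent μ F X xs (r I) I,
          feasProb μ X (subSolution F xs I ω) ^ (m - I.card)
            ∂(Measure.pi fun _ : Fin N => μ) ≤ 1 := by
  have hNm : (0 : ℝ) < N.choose m := by exact_mod_cast Nat.choose_pos hm
  have hsum := Finset.sum_le_sum fun T (hT : T ∈ Finset.powersetCard m Finset.univ) =>
    sum_integral_essentialEvent_le hxs hxs_meas hX_meas hnd r T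
  rw [Finset.sum_const, Finset.card_powersetCard, Finset.card_univ, Fintype.card_fin,
    nsmul_eq_mul, mul_one] at hsum
  have hsum' : ∑ T ∈ Finset.powersetCard m (Finset.univ : Finset (Fin N)), ∑ I ∈ T.powerset,
      ∫ ω in essentialEvent μ F X xs (r I) I,
        feasProb μ X (subSolution F xs I ω) ^ (m - I.card) ∂(Measure.pi fun _ : Fin N => μ)
      ≤ N.choose m := by
    refine le_of_eq_of_le (Finset.sum_congr rfl fun T hT => ?_) hsum
    rw [(Finset.mem_powersetCard.1 hT).2]
  rw [sum_powersetCard_sum_powerset, Fintype.card_fin] at hsum'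
  refine le_of_mul_le_mul_left ?_ hNm
  rw [mul_one]
  refine le_of_eq_of_le ?_ hsum'
  rw [Finset.mul_sum]
  refine Finset.sum_congr rfl fun I hI => ?_
  have hIm : I.card ≤ m := (Finset.mem_filter.1 hI).2
  have hNI : (0 : ℝ) < N.choose I.card := by exact_mod_cast Nat.choose_pos (hIm.trans hm)
  -- The fraction of `m`-sets that contain `I` equals `C(m,k)/C(N,k)` with `k = |I|`.
  have hch : (N.choose m : ℝ) * m.choose I.card
      = N.choose I.card * (N - I.card).choose (m - I.card) := by
    exact_mod_cast Nat.choose_mul hIm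
  rw [← mul_assoc, ← mul_div_assoc, hch, mul_div_cancel_left₀ _ hNI.ne']

/-! ### The weighted sum and the bad event -/

variable {β : ℝ} (hβ : β ∈ Set.Ioo (0 : ℝ) 1)

/-- On the event `v` lies below `t(|I|)`, where the defining polynomial is nonnegative; this
pointwise inequality is integrated. -/
theorem choose_mul_integral_essentialEvent_le [IsProbabilityMeasure μ]
    (hxs : ∀ m : ℕ, 1 ≤ m → ∀ ω : Fin m → Δ, solutionSet F X ω Set.univ = {xs m ω})
    (hxs_meas : ∀ m : ℕ, 1 ≤ m → Measurable (xs m))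
    (hX_meas : MeasurableSet {p : EuclideanSpace ℝ (Fin n) × Δ | p.1 ∈ X p.2 p.1})
    (I : Finset (Fin N)) :
    (N.choose I.card : ℝ) * ∫ ω in essentialEvent μ F X xs (scenarioT β hβ N I.card) I,
        feasProb μ X (subSolution F xs I ω) ^ (N - I.card) ∂(Measure.pi fun _ : Fin N => μ)
      ≤ β / (N + 1) * ∑ l ∈ Finset.Icc I.card N, (l.choose I.card : ℝ) *
        ∫ ω in essentialEvent μ F X xs (scenarioT β hβ N I.card) I,
          feasProb μ X (subSolution F xs I ω) ^ (l - I.card)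
            ∂(Measure.pi fun _ : Fin N => μ) := by
  set A := essentialEvent μ F X xs (scenarioT β hβ N I.card) I with hA
  have hint : ∀ k : ℕ, Integrable (fun ω => feasProb μ X (subSolution F xs I ω) ^ k)
      ((Measure.pi fun _ : Fin N => μ).restrict A) := fun k =>
    integrable_measureReal_section_pow μ (measurable_subSolution hxs_meas I) hX_meas k
  have hsum : ∀ l ∈ Finset.Icc I.card N, Integrable
      (fun ω => (l.choose I.card : ℝ) * feasProb μ X (subSolution F xs I ω) ^ (l - I.card))
      ((Measure.pi fun _ : Fin N => μ).restrict A) := fun l _ => (hint _).const_mul _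
  simp only [← integral_const_mul]
  rw [← integral_finsetSum _ hsum, ← integral_const_mul]
  refine setIntegral_mono_on ((hint _).const_mul _) ((integrable_finsetSum _ hsum).const_mul _)
    (measurableSet_essentialEvent hxs hxs_meas hX_meas _ I) fun ω hω => ?_
  obtain ⟨hpos, hlt⟩ := hω.2.2
  -- For `|I| = N` the threshold is `0` and the event is empty.
  have hk : I.card < N := by
    by_contra! hk
    rw [scenarioT_of_le hβ hk] at hlt
    exact hlt.not_gt hpos
  have := scenarioPoly_nonneg hβ hk hpos.le hlt.le
  rw [scenarioPoly] at this
  linarith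

/-- After exchanging the sums, each of the `N + 1` averaged inequalities contributes at most
`β/(N+1)`. -/
theorem sum_measureReal_essentialEvent_le [IsProbabilityMeasure μ]
    (hxs : ∀ m : ℕ, 1 ≤ m → ∀ ω : Fin m → Δ, solutionSet F X ω Set.univ = {xs m ω})
    (hxs_meas : ∀ m : ℕ, 1 ≤ m → Measurable (xs m))
    (hX_meas : MeasurableSet {p : EuclideanSpace ℝ (Fin n) × Δ | p.1 ∈ X p.2 p.1})
    (hnd : NonDegenerate μ F X N) :
    ∑ I : Finset (Fin N), (Measure.pi fun _ : Fin N => μ).real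
      (essentialEvent μ F X xs (scenarioT β hβ N I.card) I ∩
        feasEvent F X xs I (Finset.univ \ I)) ≤ β := by
  set q : Finset (Fin N) → ℕ → ℝ := fun I l =>
    ∫ ω in essentialEvent μ F X xs (scenarioT β hβ N I.card) I,
      feasProb μ X (subSolution F xs I ω) ^ (l - I.card) ∂(Measure.pi fun _ : Fin N => μ) with hq
  have hcard : ∀ I : Finset (Fin N), I.card ≤ N := fun I =>
    (Finset.card_le_univ I).trans_eq (Fintype.card_fin N)
  have hterm : ∀ I : Finset (Fin N), (Measure.pi fun _ : Fin N => μ).real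
      (essentialEvent μ F X xs (scenarioT β hβ N I.card) I ∩ feasEvent F X xs I (Finset.univ \ I))
      ≤ ∑ l ∈ Finset.Icc I.card N,
        β / (N + 1) * ((l.choose I.card : ℝ) / (N.choose I.card : ℝ) * q I l) := by
    intro I
    have hNI : (0 : ℝ) < N.choose I.card := by exact_mod_cast Nat.choose_pos (hcard I)
    have h := choose_mul_integral_essentialEvent_le (μ := μ) hβ hxs hxs_meas hX_meas I
    rw [measureReal_essentialEvent_inter hxs hxs_meas hX_meas,
      Finset.card_sdiff_of_subset (Finset.subset_univ I), Finset.card_univ, Fintype.card_fin]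
    refine ((le_div_iff₀' hNI).2 h).trans_eq ?_
    rw [← Finset.mul_sum, mul_div_assoc, Finset.sum_div]
    congr 1
    exact Finset.sum_congr rfl fun l _ => by rw [hq]; ring
  calc _ ≤ ∑ I : Finset (Fin N), ∑ l ∈ Finset.Icc I.card N,
        β / (N + 1) * ((l.choose I.card : ℝ) / (N.choose I.card : ℝ) * q I l) :=
        Finset.sum_le_sum fun I _ => hterm I
    _ = ∑ l ∈ Finset.range (N + 1),
        ∑ I ∈ (Finset.univ : Finset (Finset (Fin N))).filter (fun I => I.card ≤ l),
          β / (N + 1) * ((l.choose I.card : ℝ) / (N.choose I.card : ℝ) * q I l) := by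
        refine Finset.sum_comm' fun I l => ?_
        simp only [Finset.mem_univ, true_and, Finset.mem_Icc, Finset.mem_filter, Finset.mem_range]
        omega
    _ ≤ ∑ l ∈ Finset.range (N + 1), β / (N + 1) := by
        refine Finset.sum_le_sum fun l hl => ?_
        rw [← Finset.mul_sum]
        have := hβ.1
        exact mul_le_of_le_one_right (by positivity) (sum_choose_div_choose_mul_integral_le hxs
          hxs_meas hX_meas hnd (fun I => scenarioT β hβ N I.card)
          (Nat.lt_succ_iff.1 (Finset.mem_range.1 hl)))
    _ = β := by
        rw [Finset.sum_const, Finset.card_range, nsmul_eq_mul]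
        push_cast
        field_simp

/-- This disposes of the value `v = 0` excluded from the essential events: at least one sample lies
outside `I`, and it is feasible with conditional probability `0`. -/
theorem measure_feasProb_eq_zero_inter [IsProbabilityMeasure μ]
    (hxs_meas : ∀ m : ℕ, 1 ≤ m → Measurable (xs m))
    (hX_meas : MeasurableSet {p : EuclideanSpace ℝ (Fin n) × Δ | p.1 ∈ X p.2 p.1})
    {I : Finset (Fin N)} (hI : I.card < N) :
    (Measure.pi fun _ : Fin N => μ)
      ({ω | feasProb μ X (subSolution F xs I ω) = 0} ∩ feasEvent F X xs I Iᶜ) = 0 := by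
  have hG : MeasurableSet {ω : Fin N → Δ | feasProb μ X (subSolution F xs I ω) = 0} :=
    ((measurable_feasProb hX_meas).comp (measurable_subSolution hxs_meas I))
      (measurableSet_singleton 0)
  have h := measureReal_inter_forall_mem μ (disjoint_compl_right : Disjoint I Iᶜ) hG
    (fun ω ω' h => by
      simp only [Set.mem_ofPred_eq, subSolution_congr (F := F) (xs := xs) h])
    (measurable_subSolution (F := F) hxs_meas I) (fun _ _ h => subSolution_congr h) hX_meas
  rw [setIntegral_congr_fun (g := fun _ => (0 : ℝ)) hG] at h
  · rw [integral_zero, measureReal_eq_zero_iff] at h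
    exact h
  · intro ω hω
    have hc : Iᶜ.card ≠ 0 := by
      rw [Finset.card_compl, Fintype.card_fin]
      omega
    change feasProb μ X (subSolution F xs I ω) ^ Iᶜ.card = 0
    rw [show feasProb μ X (subSolution F xs I ω) = 0 from hω, zero_pow hc]

theorem measureReal_risk_gt_le [IsProbabilityMeasure μ]
    (hxs : ∀ m : ℕ, 1 ≤ m → ∀ ω : Fin m → Δ, solutionSet F X ω Set.univ = {xs m ω})
    (hxs_meas : ∀ m : ℕ, 1 ≤ m → Measurable (xs m))
    (hX_meas : MeasurableSet {p : EuclideanSpace ℝ (Fin n) × Δ | p.1 ∈ X p.2 p.1})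
    (hN : 1 ≤ N) (hnd : NonDegenerate μ F X N) :
    (Measure.pi fun _ : Fin N => μ).real
      {ω | 1 - scenarioT β hβ N (supportSet F X ω).card < risk μ X (xs N ω)} ≤ β := by
  refine le_trans ?_ (sum_measureReal_essentialEvent_le hβ hxs hxs_meas hX_meas hnd)
  refine le_trans ?_ (measureReal_biUnion_finset_le Finset.univ _)
  refine ENNReal.toReal_mono (measure_ne_top _ _) (measure_mono_ae ?_)
  have hnull : ∀ᵐ ω ∂(Measure.pi fun _ : Fin N => μ), ∀ I : Finset (Fin N), I.card < N →
      ¬ (ω ∈ {ω | feasProb μ X (subSolution F xs I ω) = 0} ∩ feasEvent F X xs I Iᶜ) := by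
    refine ae_all_iff.2 fun I => ?_
    by_cases hI : I.card < N
    · filter_upwards [measure_eq_zero_iff_ae_notMem.1
        (measure_feasProb_eq_zero_inter (F := F) hxs_meas hX_meas hI)] with ω hω _ using hω
    · exact Filter.Eventually.of_forall fun ω h => absurd h hI
  filter_upwards [hnd, hnull] with ω hndω hnullω hbad
  change 1 - scenarioT β hβ N (supportSet F X ω).card < risk μ X (xs N ω) at hbad
  rw [risk_eq hX_meas] at hbad
  have huniv : solutionSet F X ω (Finset.univ : Finset (Fin N)) = {xs N ω} := by
    rw [Finset.coe_univ, hxs N hN ω]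
  have hS : solutionSet F X ω (supportSet F X ω) = {xs N ω} := by rw [hndω, hxs N hN ω]
  have hx := ((solutionSet_eq_singleton_iff hxs ω _ _).1 hS).2
  have hfeas : ∀ K, ω ∈ feasEvent F X xs (supportSet F X ω) K := by
    intro K j _
    change subSolution F xs (supportSet F X ω) ω ∈ X (ω j) (subSolution F xs (supportSet F X ω) ω)
    rw [hx]
    exact mem_of_solutionSet_eq huniv (by simp)
  have hnn : 0 ≤ feasProb μ X (xs N ω) := measureReal_nonneg
  -- With `N` support constraints `t` vanishes, and a bad outcome would need a risk above `1`.
  have hk : (supportSet F X ω).card < N := by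
    by_contra! hk
    rw [scenarioT_of_le hβ hk] at hbad
    linarith
  have hne : feasProb μ X (xs N ω) ≠ 0 := fun h0 =>
    hnullω _ hk ⟨by rw [Set.mem_ofPred_eq, hx, h0], hfeas _⟩
  refine Set.mem_iUnion₂.2 ⟨supportSet F X ω, Finset.mem_univ _, ⟨?_, ?_, ?_⟩, hfeas _⟩
  · rw [hx, hS]
  · rw [hx]
    exact fun i hi => solutionSet_erase_supportSet_ne hxs huniv hi
  · rw [hx]
    exact ⟨hnn.lt_of_ne' hne, by linarith⟩

theorem one_sub_le_measureReal_risk_le [IsProbabilityMeasure μ]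
    (hxs : ∀ m : ℕ, 1 ≤ m → ∀ ω : Fin m → Δ, solutionSet F X ω Set.univ = {xs m ω})
    (hxs_meas : ∀ m : ℕ, 1 ≤ m → Measurable (xs m))
    (hX_meas : MeasurableSet {p : EuclideanSpace ℝ (Fin n) × Δ | p.1 ∈ X p.2 p.1})
    (hN : 1 ≤ N) (hnd : NonDegenerate μ F X N) :
    1 - β ≤ (Measure.pi fun _ : Fin N => μ).real
      {ω | risk μ X (xs N ω) ≤ 1 - scenarioT β hβ N (supportSet F X ω).card} := by
  have h := measureReal_risk_gt_le hβ hxs hxs_meas hX_meas hN hnd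
  -- Subadditivity holds for arbitrary sets, so measurability of the event involving the support set
  -- is not needed.
  have hun := measureReal_union_le (μ := Measure.pi fun _ : Fin N => μ)
    {ω | risk μ X (xs N ω) ≤ 1 - scenarioT β hβ N (supportSet F X ω).card}
    {ω | 1 - scenarioT β hβ N (supportSet F X ω).card < risk μ X (xs N ω)}
  have huniv : {ω | risk μ X (xs N ω) ≤ 1 - scenarioT β hβ N (supportSet F X ω).card} ∪
      {ω | 1 - scenarioT β hβ N (supportSet F X ω).card < risk μ X (xs N ω)} = Set.univ :=
    Set.eq_univ_of_forall fun ω => le_or_gt (risk μ X (xs N ω)) _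
  rw [huniv, probReal_univ] at hun
  linarith

end Essential

end ScenarioQVI

theorem theorem2 {Δ : Type*} [MeasurableSpace Δ] (μ : Measure Δ) [IsProbabilityMeasure μ]
    {n : ℕ} (F : EuclideanSpace ℝ (Fin n) → EuclideanSpace ℝ (Fin n))
    (X : Δ → EuclideanSpace ℝ (Fin n) → Set (EuclideanSpace ℝ (Fin n)))
    -- existence and uniqueness: `xs m ω` is the unique solution for the tuple `ω` of `m` samples
    (xs : ∀ m : ℕ, (Fin m → Δ) → EuclideanSpace ℝ (Fin n))
    (hxs : ∀ m : ℕ, 1 ≤ m → ∀ ω : Fin m → Δ,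
      ScenarioQVI.solutionSet F X ω Set.univ = {xs m ω})
    -- measurability
    (hxs_meas : ∀ m : ℕ, 1 ≤ m → Measurable (xs m))
    (hX_meas : MeasurableSet {p : EuclideanSpace ℝ (Fin n) × Δ | p.1 ∈ X p.2 p.1})
    (N : ℕ) (hN : 1 ≤ N) (hnd : ScenarioQVI.NonDegenerate μ F X N)
    (β : ℝ) (hβ : β ∈ Set.Ioo (0 : ℝ) 1) :
    1 - β ≤ (Measure.pi fun _ : Fin N => μ).real
        {ω | ScenarioQVI.risk μ X (xs N ω) ≤
          1 - ScenarioQVI.scenarioT β hβ N (ScenarioQVI.supportSet F X ω).card} ∧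
    (∀ ω : Fin N → Δ, (∀ i, Convex ℝ (X (ω i) (xs N ω))) →
      (ScenarioQVI.supportSet F X ω).card ≤ n) ∧
    ((∀ᵐ ω ∂(Measure.pi fun _ : Fin N => μ), ∀ i, Convex ℝ (X (ω i) (xs N ω))) →
      1 - β ≤ (Measure.pi fun _ : Fin N => μ).real
        {ω | ScenarioQVI.risk μ X (xs N ω) ≤ 1 - ScenarioQVI.scenarioT β hβ N n}) := by
  have hfirst := ScenarioQVI.one_sub_le_measureReal_risk_le hβ hxs hxs_meas hX_meas hN hnd
  refine ⟨hfirst, ScenarioQVI.card_supportSet_le hxs hN, fun hconv => ?_⟩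
  refine hfirst.trans (ENNReal.toReal_mono (measure_ne_top _ _) (measure_mono_ae ?_))
  filter_upwards [hconv] with ω hω hrisk
  -- Since `t` is antitone, `s⋆ ≤ n` gives `t(n) ≤ t(s⋆)`, so the bound with `n` is the weaker one.
  have hT := ScenarioQVI.antitone_scenarioT hβ N (ScenarioQVI.card_supportSet_le hxs hN ω hω)
  exact le_trans hrisk (by linarith)
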